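/- Let $\mathcal{C}$ be the Cesàro operator on the complex Hilbert space $L^2(\mathbb{R})$ (Lebesgue measure), $$(\mathcal{C}f)(x)=\int_0^1 f(ux)\,du ,$$ and, for $\alpha\in\mathbb{C}$ with $\mathrm{Re}(\alpha)>0$, let $H_\alpha$ be the Hölder mean operator on $L^2(\mathbb{R})$, $$(H_\alpha f)(x)=\frac1{\Gamma(\alpha)}\int_0^1\Bigl(\log\frac1u\Bigr)^{\alpha-1}f(ux)\,du ;$$ for each $f\in L^2(\mathbb{R})$ both integrals converge absolutely for a.e. $x$, and they define bounded linear operators on $L^2(\mathbb{R})$. Let $z^\alpha$ denote the branch on $\{\mathrm{Re}\,z>0\}$ with $1^\alpha=1$ (the principal branch), and put $0^\alpha:=0$. Then for every $\alpha\in\mathbb{C}$ with $\mathrm{Re}(\alpha)>0$: the operator $\mathcal{C}$ is normal, its spectrum is contained in $\{\mathrm{Re}\,z>0\}\cup\{0\}$, the function $z\mapsto z^\alpha$ is continuous on this spectrum, and the fractional power $\mathcal{C}^\alpha$, defined by the functional calculus for the normal operator $\mathcal{C}$ applied to $z\mapsto z^\alpha$, is $$\mathcal{C}^\alpha=H_\alpha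 .$$ -/

import Mathlib

open MeasureTheory Set

/-- The complex Hilbert space `L²(ℝ)` (Lebesgue measure). -/
abbrev L2R : Type := Lp ℂ 2 (volume : Measure ℝ)

/-- The Hausdorff mean `x ↦ ∫ K(u) f(ux) du` of a function `f` with kernel `K`. -/
noncomputable def hausdorffMean (K f : ℝ → ℂ) (x : ℝ) : ℂ :=
  ∫ u : ℝ, K u * f (u * x)

/-- The condition `K(u) |u|^{-1/2} ∈ L¹(ℝ)` on a kernel. -/
def HausdorffKernel (K : ℝ → ℂ) : Prop :=
  Integrable (fun u : ℝ => K u * ((|u| ^ (-(1 / 2) : ℝ) : ℝ) : ℂ))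

/-- The constant `∫ |K(u)| |u|^{-1/2} du`. -/
noncomputable def hausdorffBound (K : ℝ → ℂ) : ℝ :=
  ∫ u : ℝ, ‖K u * ((|u| ^ (-(1 / 2) : ℝ) : ℝ) : ℂ)‖

theorem lintegral_dilate_sq (F : ℝ → ENNReal) (hF : Measurable F) {u : ℝ} (hu : u ≠ 0) :
    ENNReal.ofReal |u| * ∫⁻ x : ℝ, F (u * x) = ∫⁻ x : ℝ, F x := by
  have h1 : ∫⁻ x : ℝ, F (u * x) = ENNReal.ofReal |u⁻¹| * ∫⁻ x : ℝ, F x := by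
    rw [← lintegral_map hF (measurable_const_mul u), Real.map_volume_mul_left hu,
      lintegral_smul_measure, smul_eq_mul]
  rw [h1, ← mul_assoc, ← ENNReal.ofReal_mul (abs_nonneg u), ← abs_mul, mul_inv_cancel₀ hu]
  simp

theorem lintegral_hausdorff_sq_le (w F : ℝ → ENNReal) (hw : AEMeasurable w volume)
    (hF : Measurable F) :
    ∫⁻ x : ℝ, (∫⁻ u : ℝ, w u * ENNReal.ofReal |u| ^ (1 / 2 : ℝ) * F (u * x)) ^ (2 : ℝ) ≤
      (∫⁻ u : ℝ, w u) ^ (2 : ℝ) * ∫⁻ x : ℝ, F x ^ (2 : ℝ) := by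
  have hr : Measurable (fun u : ℝ => ENNReal.ofReal |u|) := by fun_prop
  have step : ∀ x : ℝ,
      (∫⁻ u : ℝ, w u * ENNReal.ofReal |u| ^ (1 / 2 : ℝ) * F (u * x)) ^ (2 : ℝ) ≤
        (∫⁻ u : ℝ, w u) * ∫⁻ u : ℝ, w u * (ENNReal.ofReal |u| * F (u * x) ^ (2 : ℝ)) := by
    intro x
    have hFx : Measurable fun u : ℝ => F (u * x) := hF.comp (measurable_mul_const x)
    have cs := ENNReal.lintegral_mul_le_Lp_mul_Lq (volume : Measure ℝ)
      (p := 2) (q := 2) Real.HolderConjugate.two_two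
      (f := fun u => w u ^ (1 / 2 : ℝ))
      (g := fun u => w u ^ (1 / 2 : ℝ) * (ENNReal.ofReal |u| ^ (1 / 2 : ℝ) * F (u * x)))
      (hw.pow_const _) ((hw.pow_const _).mul ((hr.pow_const _).mul hFx).aemeasurable)
    have half : ∀ a : ENNReal, (a ^ (1 / 2 : ℝ)) ^ (2 : ℝ) = a := by
      intro a; rw [← ENNReal.rpow_mul]; norm_num
    have e1 : ∀ u : ℝ, ((fun u => w u ^ (1 / 2 : ℝ)) * fun u =>
        w u ^ (1 / 2 : ℝ) * (ENNReal.ofReal |u| ^ (1 / 2 : ℝ) * F (u * x))) u =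
        w u * ENNReal.ofReal |u| ^ (1 / 2 : ℝ) * F (u * x) := by
      intro u
      have : w u ^ (1 / 2 : ℝ) * w u ^ (1 / 2 : ℝ) = w u := by
        rw [← ENNReal.rpow_add_of_nonneg _ _ (by norm_num) (by norm_num)]; norm_num
      simp only [Pi.mul_apply]
      rw [← mul_assoc, this, mul_assoc]
    simp only [e1] at cs
    simp only [ENNReal.mul_rpow_of_nonneg _ _ (zero_le_two : (0 : ℝ) ≤ 2), half] at cs
    calc _ ≤ _ := ENNReal.rpow_le_rpow cs zero_le_two
      _ = _ := by rw [ENNReal.mul_rpow_of_nonneg _ _ zero_le_two, half, half]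
  refine (lintegral_mono step).trans ?_
  have hmeas : AEMeasurable (Function.uncurry fun (x u : ℝ) =>
      w u * (ENNReal.ofReal |u| * F (u * x) ^ (2 : ℝ)))
      ((volume : Measure ℝ).prod (volume : Measure ℝ)) := by
    refine AEMeasurable.mul ?_ ?_
    · exact hw.comp_quasiMeasurePreserving Measure.quasiMeasurePreserving_snd
    · refine Measurable.aemeasurable ?_
      refine (hr.comp measurable_snd).mul ?_
      exact (hF.comp (measurable_snd.mul measurable_fst)).pow_const _
  have hle : ∫⁻ x : ℝ, ∫⁻ u : ℝ, w u * (ENNReal.ofReal |u| * F (u * x) ^ (2 : ℝ)) =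
      (∫⁻ u : ℝ, w u) * ∫⁻ x : ℝ, F x ^ (2 : ℝ) := by
    rw [lintegral_lintegral_swap hmeas, ← lintegral_mul_const'' _ hw]
    refine lintegral_congr_ae ?_
    filter_upwards [Measure.ae_ne volume (0 : ℝ)] with u hu
    have hFu : Measurable fun x : ℝ => F (u * x) ^ (2 : ℝ) :=
      (hF.comp (measurable_const_mul u)).pow_const _
    rw [← lintegral_dilate_sq (fun x => F x ^ (2 : ℝ)) (hF.pow_const _) hu,
      ← lintegral_const_mul _ hFu, ← lintegral_const_mul _ (hFu.const_mul _)]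
  have hsq : ∀ a : ENNReal, a ^ (2 : ℝ) = a * a := by
    intro a; rw [ENNReal.rpow_two, sq]
  calc _ ≤ (∫⁻ u : ℝ, w u) * ∫⁻ x : ℝ, ∫⁻ u : ℝ,
          w u * (ENNReal.ofReal |u| * F (u * x) ^ (2 : ℝ)) := by
        exact (lintegral_const_mul'' _ hmeas.lintegral_prod_right').le
    _ = _ := by rw [hle, hsq, mul_assoc]

theorem HausdorffKernel.aestronglyMeasurable {K : ℝ → ℂ} (hK : HausdorffKernel K) :
    AEStronglyMeasurable K volume := by
  have h1 : AEStronglyMeasurable (fun u : ℝ =>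
      (K u * ((|u| ^ (-(1 / 2) : ℝ) : ℝ) : ℂ)) * ((|u| ^ (1 / 2 : ℝ) : ℝ) : ℂ)) volume := by
    refine Integrable.aestronglyMeasurable hK |>.mul (Measurable.aestronglyMeasurable ?_)
    fun_prop
  refine h1.congr ?_
  filter_upwards [Measure.ae_ne volume (0 : ℝ)] with u hu
  rw [mul_assoc, ← Complex.ofReal_mul, ← Real.rpow_add (abs_pos.mpr hu)]
  norm_num

theorem lintegral_hausdorff_enorm_sq_le {K : ℝ → ℂ} (hK : HausdorffKernel K) {f : ℝ → ℂ}
    (hf : StronglyMeasurable f) :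
    ∫⁻ x : ℝ, (∫⁻ u : ℝ, ‖K u * f (u * x)‖ₑ) ^ (2 : ℝ) ≤
      ENNReal.ofReal (hausdorffBound K) ^ (2 : ℝ) * ∫⁻ x : ℝ, ‖f x‖ₑ ^ (2 : ℝ) := by
  have hb : ENNReal.ofReal (hausdorffBound K) =
      ∫⁻ u : ℝ, ‖K u * ((|u| ^ (-(1 / 2) : ℝ) : ℝ) : ℂ)‖ₑ :=
    ofReal_integral_norm_eq_lintegral_enorm hK
  rw [hb]
  refine le_trans (le_of_eq ?_) (lintegral_hausdorff_sq_le
    (fun u => ‖K u * ((|u| ^ (-(1 / 2) : ℝ) : ℝ) : ℂ)‖ₑ) (fun x => ‖f x‖ₑ)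
    (Integrable.aestronglyMeasurable hK).enorm hf.enorm)
  refine lintegral_congr fun x => ?_
  congr 1
  refine lintegral_congr_ae ?_
  filter_upwards [Measure.ae_ne volume (0 : ℝ)] with u hu
  have h2 : ‖((|u| ^ (-(1 / 2) : ℝ) : ℝ) : ℂ)‖ₑ * ENNReal.ofReal |u| ^ (1 / 2 : ℝ) = 1 := by
    rw [← ofReal_norm, Complex.norm_real, Real.norm_of_nonneg (by positivity),
      ENNReal.ofReal_rpow_of_nonneg (abs_nonneg u) (by norm_num),
      ← ENNReal.ofReal_mul (by positivity), ← Real.rpow_add (abs_pos.mpr hu)]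
    norm_num
  rw [enorm_mul, enorm_mul, mul_assoc ‖K u‖ₑ, h2, mul_one]

theorem ae_integrable_hausdorff {K : ℝ → ℂ} (hK : HausdorffKernel K) (f : L2R) :
    ∀ᵐ x : ℝ, Integrable fun u : ℝ => K u * f (u * x) := by
  have hf := Lp.stronglyMeasurable f
  have hfin : ∫⁻ x : ℝ, (∫⁻ u : ℝ, ‖K u * f (u * x)‖ₑ) ^ (2 : ℝ) ≠ ⊤ := by
    refine ne_top_of_le_ne_top ?_ (lintegral_hausdorff_enorm_sq_le hK hf)
    refine ENNReal.mul_ne_top (ENNReal.rpow_ne_top_of_nonneg zero_le_two ENNReal.ofReal_ne_top) ?_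
    have := (eLpNorm_lt_top_iff_lintegral_rpow_enorm_lt_top two_ne_zero ENNReal.ofNat_ne_top).1
      (Lp.eLpNorm_lt_top f)
    simpa using this.ne
  have hmeas : AEMeasurable (fun x : ℝ => (∫⁻ u : ℝ, ‖K u * f (u * x)‖ₑ) ^ (2 : ℝ)) volume := by
    refine AEMeasurable.pow_const ?_ _
    refine AEMeasurable.lintegral_prod_right'
      (f := fun p : ℝ × ℝ => ‖K p.2 * f (p.2 * p.1)‖ₑ) ?_
    refine AEStronglyMeasurable.enorm ?_
    refine hK.aestronglyMeasurable.comp_snd.mul ?_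
    exact (hf.comp_measurable (measurable_snd.mul measurable_fst)).aestronglyMeasurable
  filter_upwards [ae_lt_top' hmeas hfin] with x hx
  refine ⟨hK.aestronglyMeasurable.mul
    (hf.comp_measurable (measurable_mul_const x)).aestronglyMeasurable, ?_⟩
  by_contra h
  have : (∫⁻ u : ℝ, ‖K u * f (u * x)‖ₑ) = ⊤ := by
    simpa [HasFiniteIntegral] using h
  rw [this] at hx
  simp at hx

theorem eLpNorm_hausdorffMean_le {K : ℝ → ℂ} (hK : HausdorffKernel K) (f : L2R) :
    eLpNorm (hausdorffMean K f) 2 volume ≤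
      ENNReal.ofReal (hausdorffBound K) * eLpNorm f 2 volume := by
  have h := lintegral_hausdorff_enorm_sq_le hK (Lp.stronglyMeasurable f)
  rw [eLpNorm_eq_lintegral_rpow_enorm_toReal two_ne_zero ENNReal.ofNat_ne_top,
    eLpNorm_eq_lintegral_rpow_enorm_toReal two_ne_zero ENNReal.ofNat_ne_top, ENNReal.toReal_ofNat]
  calc (∫⁻ x : ℝ, ‖hausdorffMean K f x‖ₑ ^ (2 : ℝ)) ^ (1 / 2 : ℝ)
      ≤ (∫⁻ x : ℝ, (∫⁻ u : ℝ, ‖K u * f (u * x)‖ₑ) ^ (2 : ℝ)) ^ (1 / 2 : ℝ) := by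
        gcongr with x
        exact enorm_integral_le_lintegral_enorm _
    _ ≤ (ENNReal.ofReal (hausdorffBound K) ^ (2 : ℝ) *
          ∫⁻ x : ℝ, ‖f x‖ₑ ^ (2 : ℝ)) ^ (1 / 2 : ℝ) := by gcongr
    _ = _ := by
        rw [ENNReal.mul_rpow_of_nonneg _ _ (by norm_num), ← ENNReal.rpow_mul]
        norm_num

theorem memLp_hausdorffMean {K : ℝ → ℂ} (hK : HausdorffKernel K) (f : L2R) :
    MemLp (hausdorffMean K f) 2 volume := by
  refine ⟨?_, (eLpNorm_hausdorffMean_le hK f).trans_lt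
    (ENNReal.mul_lt_top ENNReal.ofReal_lt_top (Lp.eLpNorm_lt_top f))⟩
  refine AEStronglyMeasurable.integral_prod_right'
    (f := fun p : ℝ × ℝ => K p.2 * f (p.2 * p.1)) ?_
  refine hK.aestronglyMeasurable.comp_snd.mul ?_
  exact ((Lp.stronglyMeasurable f).comp_measurable
    (measurable_snd.mul measurable_fst)).aestronglyMeasurable

theorem hausdorffMean_congr (K : ℝ → ℂ) {f g : ℝ → ℂ} (h : f =ᵐ[volume] g) {x : ℝ}
    (hx : x ≠ 0) : hausdorffMean K f x = hausdorffMean K g x := by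
  refine integral_congr_ae ?_
  have hq : Measure.QuasiMeasurePreserving (fun u : ℝ => u * x) volume volume := by
    refine ⟨measurable_mul_const x, ?_⟩
    rw [Real.map_volume_mul_right hx]
    exact Measure.smul_absolutelyContinuous
  filter_upwards [hq.ae h] with u hu
  rw [hu]

/-- The Hausdorff operator `(𝓗_K f)(x) = ∫ K(u) f(ux) du` as a bounded operator on `L²(ℝ)`,
for a kernel with `K(u) |u|^{-1/2} ∈ L¹(ℝ)`. -/
noncomputable def hausdorffOperator (K : ℝ → ℂ) (hK : HausdorffKernel K) : L2R →L[ℂ] L2R :=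
  LinearMap.mkContinuous
    { toFun := fun f => (memLp_hausdorffMean hK f).toLp (hausdorffMean K f)
      map_add' := fun f g => by
        rw [← MemLp.toLp_add]
        refine MemLp.toLp_congr _ _ ?_
        filter_upwards [Measure.ae_ne volume (0 : ℝ), ae_integrable_hausdorff hK f,
          ae_integrable_hausdorff hK g] with x hx hfx hgx
        rw [hausdorffMean_congr K (Lp.coeFn_add f g) hx]
        simp only [hausdorffMean, Pi.add_apply, mul_add]
        exact integral_add hfx hgx
      map_smul' := fun c f => by
        rw [RingHom.id_apply, ← MemLp.toLp_const_smul]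
        refine MemLp.toLp_congr _ _ ?_
        filter_upwards [Measure.ae_ne volume (0 : ℝ)] with x hx
        rw [hausdorffMean_congr K (Lp.coeFn_smul c f) hx]
        simp only [hausdorffMean, Pi.smul_apply, smul_eq_mul]
        rw [← integral_const_mul]
        refine integral_congr_ae (Filter.Eventually.of_forall fun u => ?_)
        simp only
        ring }
    (hausdorffBound K)
    (fun f => by
      change ‖(memLp_hausdorffMean hK f).toLp (hausdorffMean K f)‖ ≤ _
      rw [Lp.norm_toLp, Lp.norm_def]
      have hb : 0 ≤ hausdorffBound K := integral_nonneg fun _ => norm_nonneg _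
      rw [← ENNReal.toReal_ofReal hb, ← ENNReal.toReal_mul]
      exact ENNReal.toReal_mono
        (ENNReal.mul_ne_top ENNReal.ofReal_ne_top (Lp.eLpNorm_lt_top f).ne)
        (eLpNorm_hausdorffMean_le hK f))

theorem hausdorffOperator_coe {K : ℝ → ℂ} (hK : HausdorffKernel K) (f : L2R) :
    (hausdorffOperator K hK f : ℝ → ℂ) =ᵐ[volume] hausdorffMean K f :=
  (memLp_hausdorffMean hK f).coeFn_toLp

/-- The kernel `K(u) = Γ(α)⁻¹ (log (1/u))^{α-1} χ_{(0,1)}(u)`. -/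
noncomputable def holderKernel (α : ℂ) : ℝ → ℂ :=
  (Ioo (0 : ℝ) 1).indicator fun u => (Complex.Gamma α)⁻¹ * (Real.log (1 / u) : ℂ) ^ (α - 1)

theorem holderKernel_hausdorffKernel {α : ℂ} (hα : 0 < α.re) :
    HausdorffKernel (holderKernel α) := by
  have himg : (fun t : ℝ => Real.exp (-t)) '' Ioi 0 = Ioo 0 1 := by
    ext u
    constructor
    · rintro ⟨t, ht, rfl⟩
      exact ⟨Real.exp_pos _, by simpa using ht⟩
    · rintro ⟨h0, h1⟩
      exact ⟨-Real.log u, by simpa using Real.log_neg h0 h1, by simp [Real.exp_log h0]⟩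
  have hreal : IntegrableOn (fun u : ℝ => Real.log (1 / u) ^ (α.re - 1) * u ^ (-(1 / 2) : ℝ))
      (Ioo 0 1) volume := by
    rw [← himg, integrableOn_image_iff_integrableOn_abs_deriv_smul measurableSet_Ioi
      (f' := fun t => -Real.exp (-t))
      (fun t _ => by simpa using ((hasDerivAt_neg t).exp).hasDerivWithinAt)
      (fun a _ b _ h => by simpa using h)]
    refine (integrableOn_rpow_mul_exp_neg_mul_rpow (p := 1) (s := α.re - 1) (b := 1 / 2)
      (by linarith) one_pos (by norm_num)).congr_fun (fun t _ => ?_) measurableSet_Ioi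
    simp only [abs_neg, Real.abs_exp, smul_eq_mul, one_div, Real.log_inv, Real.log_exp, neg_neg,
      Real.rpow_one]
    rw [← Real.exp_mul, mul_left_comm, ← Real.exp_add]
    congr 2
    ring
  have hc : IntegrableOn (fun u : ℝ => ((Complex.Gamma α)⁻¹ * (Real.log (1 / u) : ℂ) ^ (α - 1)) *
      ((|u| ^ (-(1 / 2) : ℝ) : ℝ) : ℂ)) (Ioo 0 1) volume := by
    refine Integrable.mono' (hreal.const_mul ‖(Complex.Gamma α)⁻¹‖) ?_ ?_
    · refine Measurable.aestronglyMeasurable ?_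
      fun_prop
    · refine (ae_restrict_iff' measurableSet_Ioo).2 (Filter.Eventually.of_forall ?_)
      rintro u ⟨h0, h1⟩
      have hl : 0 < Real.log (1 / u) := by
        simpa using Real.log_neg h0 h1
      rw [norm_mul, norm_mul, Complex.norm_cpow_eq_rpow_re_of_pos hl, Complex.norm_real,
        Real.norm_of_nonneg (by positivity), abs_of_pos h0, mul_assoc]
      simp
  refine (hc.integrable_indicator measurableSet_Ioo).congr
    (Filter.Eventually.of_forall fun u => ?_)
  by_cases hu : u ∈ Ioo (0 : ℝ) 1 <;> simp [holderKernel, hu]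

/-- The Hölder mean operator `(H_α f)(x) = Γ(α)⁻¹ ∫₀¹ (log (1/u))^{α-1} f(ux) du` on `L²(ℝ)`,
for `Re α > 0`. -/
noncomputable def holderOperator (α : ℂ) (hα : 0 < α.re) : L2R →L[ℂ] L2R :=
  hausdorffOperator (holderKernel α) (holderKernel_hausdorffKernel hα)

theorem holderOperator_coe {α : ℂ} (hα : 0 < α.re) (f : L2R) :
    (holderOperator α hα f : ℝ → ℂ) =ᵐ[volume] fun x =>
      (Complex.Gamma α)⁻¹ * ∫ u in Ioo (0 : ℝ) 1, (Real.log (1 / u) : ℂ) ^ (α - 1) * f (u * x) := by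
  refine (hausdorffOperator_coe _ f).trans (Filter.Eventually.of_forall fun x => ?_)
  simp only [hausdorffMean]
  rw [← integral_const_mul, ← integral_indicator measurableSet_Ioo]
  refine integral_congr_ae (Filter.Eventually.of_forall fun u => ?_)
  by_cases hu : u ∈ Ioo (0 : ℝ) 1 <;> simp [holderKernel, hu, mul_assoc]

/-- The kernel `χ_{(0,1)}`. -/
noncomputable def cesaroKernel : ℝ → ℂ :=
  (Ioo (0 : ℝ) 1).indicator fun _ => 1

theorem cesaroKernel_hausdorffKernel : HausdorffKernel cesaroKernel := by
  have h := holderKernel_hausdorffKernel (α := 1) (by simp)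
  simpa [holderKernel, cesaroKernel] using h

/-- The Cesàro operator `(𝓒 f)(x) = ∫₀¹ f(ux) du` on `L²(ℝ)`. -/
noncomputable def cesaroOperator : L2R →L[ℂ] L2R :=
  hausdorffOperator cesaroKernel cesaroKernel_hausdorffKernel

theorem cesaroOperator_coe (f : L2R) :
    (cesaroOperator f : ℝ → ℂ) =ᵐ[volume] fun x => ∫ u in Ioo (0 : ℝ) 1, f (u * x) := by
  refine (hausdorffOperator_coe _ f).trans (Filter.Eventually.of_forall fun x => ?_)
  simp only [hausdorffMean]
  rw [← integral_indicator measurableSet_Ioo]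
  refine integral_congr_ae (Filter.Eventually.of_forall fun u => ?_)
  by_cases hu : u ∈ Ioo (0 : ℝ) 1 <;> simp [cesaroKernel, hu]

/-! Fubini turns composition of Hausdorff operators into multiplicative convolution of kernels
(`hausdorffOperator_comp`). Dilation by `u` has adjoint `|u|⁻¹` times dilation by `u⁻¹`, so the
adjoint of `𝓒` has kernel `u⁻¹` on `(1,∞)` (`star_cesaroOperator`). Two elementary convolutions then
give `𝓒𝓒* = 𝓒 + 𝓒* = 𝓒*𝓒`. Hence `𝓒` is normal and `1 - 𝓒` is unitary; every spectral value lies on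
`|1 - z| = 1`, which away from `0` is the curve `Re (1/z) = 1/2`.

For a kernel `K` on `(0,1)`, the operator should be `φ(𝓒)` with `φ(z) = ∫₀¹ K(u) u^{s-1} du`, `s =
1/z`. For `K = u^m` this is `z/(1 + mz)`, and it is proved directly: the monomial operator satisfies
`P (1 + m𝓒) = 𝓒`, and `1 + m𝓒` is invertible (`cfc_div_one_add_nat_mul`). By linearity it holds for
polynomials (`exists_cfc_eq_polynomialOperator`).

The Hölder kernel has Mellin transform `s^{-α} = z^α` (`integral_holderKernel_mul_cpow`). On `Re s =
1/2` one has `|u^{s-1}| = u^{-1/2}`, so the single constant `hausdorffBound` controls both the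
operator norm and the supremum of the Mellin transform over the nonzero spectrum. Polynomials are
dense in this weighted `L¹` norm on `(0,1)`, so the identity passes from polynomial kernels to the
Hölder kernel. -/

/-! ### Hausdorff operators: composition, pairings and dependence on the kernel. -/

theorem quasiMeasurePreserving_mul_right {x : ℝ} (hx : x ≠ 0) :
    Measure.QuasiMeasurePreserving (fun u : ℝ => u * x) volume volume := by
  refine ⟨measurable_mul_const x, ?_⟩
  rw [Real.map_volume_mul_right hx]
  exact Measure.smul_absolutelyContinuous

theorem HausdorffKernel.norm {K : ℝ → ℂ} (hK : HausdorffKernel K) :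
    HausdorffKernel fun u => (‖K u‖ : ℂ) := by
  have h := (Integrable.norm hK).ofReal (𝕜 := ℂ)
  refine h.congr (Filter.Eventually.of_forall fun u => ?_)
  simp only [norm_mul, Complex.norm_real, Real.norm_eq_abs, Complex.coe_algebraMap,
    abs_of_nonneg (Real.rpow_nonneg (abs_nonneg u) _), Complex.ofReal_mul]

/-- The pointwise absolute value of an element of `L²(ℝ)`. -/
noncomputable def normL2R (f : L2R) : L2R :=
  MemLp.toLp (fun x => (‖f x‖ : ℂ)) ((Lp.memLp f).norm.ofReal (K := ℂ))

theorem normL2R_coe (f : L2R) : (normL2R f : ℝ → ℂ) =ᵐ[volume] fun x => (‖f x‖ : ℂ) :=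
  MemLp.coeFn_toLp _

/-- The Hausdorff mean of `|f|` with kernel `|K|`. -/
theorem hausdorffOperator_norm_coe {K : ℝ → ℂ} (hK : HausdorffKernel K) (f : L2R) :
    (hausdorffOperator _ hK.norm (normL2R f) : ℝ → ℂ) =ᵐ[volume]
      fun x => ((∫ u : ℝ, ‖K u‖ * ‖f (u * x)‖ : ℝ) : ℂ) := by
  filter_upwards [hausdorffOperator_coe hK.norm (normL2R f),
    Measure.ae_ne volume (0 : ℝ)] with x hx h0
  rw [hx, hausdorffMean_congr _ (normL2R_coe f) h0, hausdorffMean, ← integral_complex_ofReal]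
  simp

/-- Tonelli: with `v = w/u`, whose Jacobian accounts for `|u|⁻¹`, the inner integral of absolute
values is `|K u|` times the mean of `|f|` with kernel `|L|`, taken at `ux`. That mean is itself in
`L²`, so its `|K|`-mean converges for a.e. `x`. This is the hypothesis for exchanging the integrals
in a composition. -/
theorem integrable_hausdorff_comp {K L : ℝ → ℂ} (mK : Measurable K) (mL : Measurable L)
    (hK : HausdorffKernel K) (hL : HausdorffKernel L) (f : L2R) :
    ∀ᵐ x : ℝ, Integrable (Function.uncurry fun u w : ℝ =>
      K u * ((|u|⁻¹ : ℝ) : ℂ) * (L (w / u) * f (w * x))) (volume.prod volume) := by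
  have mf := (Lp.stronglyMeasurable f).measurable
  have h1 := hausdorffOperator_norm_coe hL f
  have h2 := ae_integrable_hausdorff hL f
  filter_upwards [ae_integrable_hausdorff hK (hausdorffOperator _ hL.norm (normL2R f)),
    Measure.ae_ne volume (0 : ℝ)] with x hx h0
  have q := quasiMeasurePreserving_mul_right h0
  have hs : ∀ u : ℝ, u ≠ 0 → ∀ w : ℝ, K u * ((|u|⁻¹ : ℝ) : ℂ) * (L (w / u) * f (w * x)) =
      K u * ((|u|⁻¹ : ℝ) : ℂ) * (fun v => L v * f (v * (u * x))) (w / u) := by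
    intro u hu w
    have : w / u * (u * x) = w * x := by field_simp
    simp only [this]
  refine (integrable_prod_iff ?_).2 ⟨?_, ?_⟩
  · refine Measurable.aestronglyMeasurable ?_
    simp only [Function.uncurry_def]
    fun_prop
  · filter_upwards [q.ae h2, Measure.ae_ne volume (0 : ℝ)] with u hu hu0
    simp only [Function.uncurry_apply_pair]
    simp_rw [hs u hu0]
    exact (hu.comp_div hu0).const_mul _
  · refine hx.norm.congr ?_
    filter_upwards [q.ae h1, Measure.ae_ne volume (0 : ℝ)] with u hu hu0
    rw [hu]
    simp only [Function.uncurry_apply_pair]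
    simp_rw [hs u hu0, norm_mul]
    rw [integral_const_mul, Measure.integral_comp_div (fun v => ‖L v‖ * ‖f (v * (u * x))‖),
      Complex.norm_real, Complex.norm_real, smul_eq_mul, norm_inv, Real.norm_eq_abs |u|, abs_abs,
      Real.norm_of_nonneg (integral_nonneg fun _ => by positivity), mul_assoc, ← mul_assoc (|u|⁻¹),
      inv_mul_cancel₀ (abs_pos.2 hu0).ne', one_mul]

/-- Hausdorff operators compose by multiplicative convolution of their kernels. -/
theorem hausdorffOperator_comp {K L M : ℝ → ℂ} (mK : Measurable K) (mL : Measurable L)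
    (hK : HausdorffKernel K) (hL : HausdorffKernel L) (hM : HausdorffKernel M)
    (h : ∀ᵐ w : ℝ, ∫ u : ℝ, K u * ((|u|⁻¹ : ℝ) : ℂ) * L (w / u) = M w) :
    hausdorffOperator K hK * hausdorffOperator L hL = hausdorffOperator M hM := by
  refine ContinuousLinearMap.ext fun f => Lp.ext ?_
  have h1 := hausdorffOperator_coe hL f
  rw [mul_apply_eq_comp]
  filter_upwards [integrable_hausdorff_comp mK mL hK hL f, Measure.ae_ne volume (0 : ℝ),
    hausdorffOperator_coe hK (hausdorffOperator L hL f), hausdorffOperator_coe hM f]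
    with x hx h0 e1 e2
  have q := quasiMeasurePreserving_mul_right h0
  rw [e1, e2]
  calc hausdorffMean K (hausdorffOperator L hL f) x
      = ∫ u : ℝ, ∫ w : ℝ, K u * ((|u|⁻¹ : ℝ) : ℂ) * (L (w / u) * f (w * x)) := by
        refine integral_congr_ae ?_
        filter_upwards [q.ae h1, Measure.ae_ne volume (0 : ℝ)] with u hu hu0
        have hs : ∀ w : ℝ, L (w / u) * f (w * x) = (fun v => L v * f (v * (u * x))) (w / u) := by
          intro w
          have : w / u * (u * x) = w * x := by field_simp
          simp only [this]
        simp_rw [hs]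
        rw [hu, integral_const_mul, Measure.integral_comp_div (fun v => L v * f (v * (u * x))), hausdorffMean, Complex.real_smul,
          mul_assoc, ← mul_assoc (((|u|⁻¹ : ℝ) : ℂ)), ← Complex.ofReal_mul,
          inv_mul_cancel₀ (abs_pos.2 hu0).ne', Complex.ofReal_one, one_mul]
    _ = ∫ w : ℝ, ∫ u : ℝ, K u * ((|u|⁻¹ : ℝ) : ℂ) * (L (w / u) * f (w * x)) :=
        integral_integral_swap hx
    _ = hausdorffMean M f x := by
        refine integral_congr_ae ?_
        filter_upwards [h] with w hw
        simp_rw [← mul_assoc]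
        rw [integral_mul_const, hw]

/-- The pairing `u ↦ ∫ conj (g x) f(ux) dx`. -/
noncomputable def dilationPairing (g f : ℝ → ℂ) (u : ℝ) : ℂ :=
  ∫ x : ℝ, inner ℂ (g x) (f (u * x))

/-- Fubini, with absolute convergence supplied by pairing `g` with the `|K|`-mean of `|f|`, an
element of `L²`. In this weak form an adjoint is found by a change of variable in `u` alone. -/
theorem inner_hausdorffOperator {K : ℝ → ℂ} (hK : HausdorffKernel K) (g f : L2R) :
    inner ℂ g (hausdorffOperator K hK f) = ∫ u : ℝ, K u * dilationPairing g f u := by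
  have mf := (Lp.stronglyMeasurable f)
  have mg := (Lp.stronglyMeasurable g)
  have hi : Integrable (Function.uncurry fun x u : ℝ => inner ℂ (g x) (K u * f (u * x)))
      (volume.prod volume) := by
    refine (integrable_prod_iff ?_).2 ⟨?_, ?_⟩
    · refine AEStronglyMeasurable.inner ?_ ?_
      · exact mg.aestronglyMeasurable.comp_fst
      · refine hK.aestronglyMeasurable.comp_snd.mul ?_
        exact (mf.comp_measurable (measurable_snd.mul measurable_fst)).aestronglyMeasurable
    · filter_upwards [ae_integrable_hausdorff hK f] with x hx
      exact hx.const_inner (𝕜 := ℂ) (g x)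
    · have h := (L2.integrable_inner (𝕜 := ℂ) g (hausdorffOperator _ hK.norm (normL2R f))).norm
      refine h.congr ?_
      filter_upwards [hausdorffOperator_norm_coe hK f] with x hx
      rw [hx]
      simp only [RCLike.inner_apply, norm_mul, Complex.norm_real, Function.uncurry_apply_pair]
      rw [Real.norm_of_nonneg (integral_nonneg fun _ => by positivity), integral_mul_const]
  rw [L2.inner_def]
  calc _ = ∫ x : ℝ, ∫ u : ℝ, inner ℂ (g x) (K u * f (u * x)) := by
        refine integral_congr_ae ?_
        filter_upwards [hausdorffOperator_coe hK f, ae_integrable_hausdorff hK f] with x hx hi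
        rw [hx, hausdorffMean]
        exact (integral_inner hi _).symm
    _ = ∫ u : ℝ, ∫ x : ℝ, inner ℂ (g x) (K u * f (u * x)) := integral_integral_swap hi
    _ = _ := by
        refine integral_congr_ae (Filter.Eventually.of_forall fun u => ?_)
        simp only [dilationPairing]
        rw [← integral_const_mul]
        refine integral_congr_ae (Filter.Eventually.of_forall fun x => ?_)
        simp only [RCLike.inner_apply, mul_assoc]

/-- Substituting `x ↦ ux` moves the dilation from one argument of the inner product to the other. -/
theorem dilationPairing_conj (f g : ℝ → ℂ) {u : ℝ} (hu : u ≠ 0) :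
    (starRingEnd ℂ) (dilationPairing f g u⁻¹) = ((|u| : ℝ) : ℂ) * dilationPairing g f u := by
  have h := Measure.integral_comp_mul_left
    (fun x => (starRingEnd ℂ) (inner ℂ (f x) (g (u⁻¹ * x)))) u
  rw [abs_inv, Complex.real_smul, integral_conj (f := fun x => inner ℂ (f x) (g (u⁻¹ * x)))] at h
  rw [dilationPairing, dilationPairing]
  have h' : ((|u| : ℝ) : ℂ) ≠ 0 := by simpa using hu
  rw [Complex.ofReal_inv, eq_inv_mul_iff_mul_eq₀ h'] at h
  rw [← h]
  congr 1
  refine integral_congr_ae (Filter.Eventually.of_forall fun x => ?_)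
  simp only [inner_conj_symm, inv_mul_cancel_left₀ hu]

theorem hausdorffOperator_congr {K L : ℝ → ℂ} (hK : HausdorffKernel K) (hL : HausdorffKernel L)
    (h : K =ᵐ[volume] L) : hausdorffOperator K hK = hausdorffOperator L hL := by
  refine ContinuousLinearMap.ext fun f => Lp.ext ?_
  filter_upwards [hausdorffOperator_coe hK f, hausdorffOperator_coe hL f] with x h1 h2
  rw [h1, h2]
  refine integral_congr_ae ?_
  filter_upwards [h] with u hu
  rw [hu]

theorem HausdorffKernel.add {K L : ℝ → ℂ} (hK : HausdorffKernel K) (hL : HausdorffKernel L) :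
    HausdorffKernel (K + L) :=
  (Integrable.add hK hL).congr (Filter.Eventually.of_forall fun u => by simp [add_mul])

theorem HausdorffKernel.smul {K : ℝ → ℂ} (hK : HausdorffKernel K) (c : ℂ) :
    HausdorffKernel (c • K) :=
  (Integrable.smul c hK).congr (Filter.Eventually.of_forall fun u => by simp [mul_assoc])

theorem hausdorffOperator_add {K L : ℝ → ℂ} (hK : HausdorffKernel K) (hL : HausdorffKernel L) :
    hausdorffOperator (K + L) (hK.add hL) = hausdorffOperator K hK + hausdorffOperator L hL := by
  refine ContinuousLinearMap.ext fun f => Lp.ext ?_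
  rw [add_apply]
  filter_upwards [hausdorffOperator_coe hK f, hausdorffOperator_coe hL f,
    hausdorffOperator_coe (hK.add hL) f, ae_integrable_hausdorff hK f,
    ae_integrable_hausdorff hL f,
    Lp.coeFn_add (hausdorffOperator K hK f) (hausdorffOperator L hL f)] with x h1 h2 h3 i1 i2 h4
  rw [h3, h4, Pi.add_apply, h1, h2]
  simp only [hausdorffMean, Pi.add_apply, add_mul]
  exact integral_add i1 i2

theorem hausdorffOperator_smul {K : ℝ → ℂ} (hK : HausdorffKernel K) (c : ℂ) :
    hausdorffOperator (c • K) (hK.smul c) = c • hausdorffOperator K hK := by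
  refine ContinuousLinearMap.ext fun f => Lp.ext ?_
  rw [smul_apply]
  filter_upwards [hausdorffOperator_coe hK f, hausdorffOperator_coe (hK.smul c) f,
    Lp.coeFn_smul c (hausdorffOperator K hK f)] with x h1 h3 h4
  rw [h3, h4, Pi.smul_apply, h1]
  simp only [hausdorffMean, Pi.smul_apply, smul_eq_mul, mul_assoc]
  exact integral_const_mul _ _

theorem norm_hausdorffOperator_le {K : ℝ → ℂ} (hK : HausdorffKernel K) :
    ‖hausdorffOperator K hK‖ ≤ hausdorffBound K :=
  LinearMap.mkContinuous_norm_le _ (integral_nonneg fun _ => norm_nonneg _) _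

/-! ### The adjoint of the Cesàro operator and its products with it. -/

/-- The kernel `u ↦ u⁻¹ χ_{(1,∞)}(u)` of the adjoint of the Cesàro operator. -/
noncomputable def cesaroAdjointKernel : ℝ → ℂ :=
  (Ioi (1 : ℝ)).indicator fun u => ((u⁻¹ : ℝ) : ℂ)

theorem cesaroAdjointKernel_hausdorffKernel : HausdorffKernel cesaroAdjointKernel := by
  have h := (integrableOn_Ioi_rpow_of_lt (a := -(3 / 2)) (by norm_num) one_pos).integrable_indicator
    measurableSet_Ioi
  refine (h.ofReal (𝕜 := ℂ)).congr (Filter.Eventually.of_forall fun u => ?_)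
  by_cases hu : u ∈ Ioi (1 : ℝ)
  · have hu0 : 0 < u := one_pos.trans hu
    simp only [cesaroAdjointKernel, indicator_of_mem hu, Complex.coe_algebraMap,
      ← Complex.ofReal_mul, abs_of_pos hu0, ← Real.rpow_neg_one u, ← Real.rpow_add hu0]
    norm_num
  · simp [cesaroAdjointKernel, indicator_of_notMem hu]

theorem measurable_cesaroKernel : Measurable cesaroKernel :=
  measurable_const.indicator measurableSet_Ioo

theorem measurable_cesaroAdjointKernel : Measurable cesaroAdjointKernel :=
  (by fun_prop : Measurable fun u : ℝ => ((u⁻¹ : ℝ) : ℂ)).indicator measurableSet_Ioi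

/-- For `w > 0` the integrand is the constant `w⁻¹` on `(0, min 1 w)`, so the integral is `min 1 w /
w`. At `w = 1` this is `1`, whereas both kernels on the right vanish there. -/
theorem cesaroKernel_conv_adjoint (w : ℝ) (hw1 : w ≠ 1) :
    ∫ u : ℝ, cesaroKernel u * ((|u|⁻¹ : ℝ) : ℂ) * cesaroAdjointKernel (w / u) =
      (cesaroKernel + cesaroAdjointKernel) w := by
  rcases le_or_gt w 0 with hw | hw
  · have h : ∀ u, cesaroKernel u * ((|u|⁻¹ : ℝ) : ℂ) * cesaroAdjointKernel (w / u) = 0 := by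
      intro u
      by_cases hu : u ∈ Ioo (0 : ℝ) 1
      · have : w / u ∉ Ioi (1 : ℝ) := by
          have := div_nonpos_of_nonpos_of_nonneg hw hu.1.le
          simp only [mem_Ioi, not_lt]; linarith
        simp [cesaroAdjointKernel, this]
      · simp [cesaroKernel, hu]
    have h1 : w ∉ Ioo (0 : ℝ) 1 := fun h => h.1.not_ge hw
    have h2 : w ∉ Ioi (1 : ℝ) := fun h => (one_pos.trans h).not_ge hw
    simp_rw [h]
    simp [cesaroKernel, cesaroAdjointKernel, h1, h2]
  · have h : ∀ u, cesaroKernel u * ((|u|⁻¹ : ℝ) : ℂ) * cesaroAdjointKernel (w / u) =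
        (Ioo 0 (min 1 w)).indicator (fun _ => ((w⁻¹ : ℝ) : ℂ)) u := by
      intro u
      by_cases hu : u ∈ Ioo (0 : ℝ) 1
      · by_cases huw : u < w
        · have h1 : w / u ∈ Ioi (1 : ℝ) := (one_lt_div hu.1).2 huw
          have h2 : u ∈ Ioo 0 (min 1 w) := ⟨hu.1, lt_min hu.2 huw⟩
          have h3 : (u : ℂ) ≠ 0 := by exact_mod_cast hu.1.ne'
          simp [cesaroKernel, cesaroAdjointKernel, hu, h1, h2, abs_of_pos hu.1]
          field_simp
        · have h1 : w / u ∉ Ioi (1 : ℝ) := fun h => huw ((one_lt_div hu.1).1 h)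
          have h2 : u ∉ Ioo 0 (min 1 w) := fun h => huw (h.2.trans_le (min_le_right _ _))
          simp [cesaroAdjointKernel, h1, h2]
      · have h2 : u ∉ Ioo 0 (min 1 w) := fun h => hu ⟨h.1, h.2.trans_le (min_le_left _ _)⟩
        simp [cesaroKernel, hu, h2]
    simp_rw [h]
    rw [integral_indicator measurableSet_Ioo, setIntegral_const, Measure.real, Real.volume_Ioo,
      sub_zero, ENNReal.toReal_ofReal (le_min zero_le_one hw.le), Complex.real_smul]
    rcases lt_or_gt_of_ne hw1 with h1 | h1
    · have h2 : w ∉ Ioi (1 : ℝ) := fun h => h1.not_gt h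
      have h3 : w ∈ Ioo (0 : ℝ) 1 := ⟨hw, h1⟩
      rw [min_eq_right h1.le, ← Complex.ofReal_mul, mul_inv_cancel₀ hw.ne']
      simp [cesaroKernel, cesaroAdjointKernel, h2, h3]
    · have h2 : w ∈ Ioi (1 : ℝ) := h1
      have h3 : w ∉ Ioo (0 : ℝ) 1 := fun h => h.2.not_gt h1
      rw [min_eq_left h1.le]
      simp [cesaroKernel, cesaroAdjointKernel, h2, h3]

/-- For `w > 0` the integrand is `u⁻²` on `(max 1 w, ∞)`, so the integral is `1 / max 1 w`, the same
function as `min 1 w / w`. -/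
theorem cesaroAdjointKernel_conv_cesaro (w : ℝ) (hw1 : w ≠ 1) :
    ∫ u : ℝ, cesaroAdjointKernel u * ((|u|⁻¹ : ℝ) : ℂ) * cesaroKernel (w / u) =
      (cesaroKernel + cesaroAdjointKernel) w := by
  rcases le_or_gt w 0 with hw | hw
  · have h : ∀ u, cesaroAdjointKernel u * ((|u|⁻¹ : ℝ) : ℂ) * cesaroKernel (w / u) = 0 := by
      intro u
      by_cases hu : u ∈ Ioi (1 : ℝ)
      · have : w / u ∉ Ioo (0 : ℝ) 1 := fun h =>
          h.1.not_ge (div_nonpos_of_nonpos_of_nonneg hw (one_pos.trans hu).le)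
        simp [cesaroKernel, this]
      · simp [cesaroAdjointKernel, hu]
    have h1 : w ∉ Ioo (0 : ℝ) 1 := fun h => h.1.not_ge hw
    have h2 : w ∉ Ioi (1 : ℝ) := fun h => (one_pos.trans h).not_ge hw
    simp_rw [h]
    simp [cesaroKernel, cesaroAdjointKernel, h1, h2]
  · have h : ∀ u, cesaroAdjointKernel u * ((|u|⁻¹ : ℝ) : ℂ) * cesaroKernel (w / u) =
        (((Ioi (max 1 w)).indicator (fun u : ℝ => u ^ (-2 : ℝ)) u : ℝ) : ℂ) := by
      intro u
      by_cases hu : u ∈ Ioi (1 : ℝ)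
      · have hu0 : 0 < u := one_pos.trans hu
        by_cases huw : w < u
        · have h1 : w / u ∈ Ioo (0 : ℝ) 1 := ⟨div_pos hw hu0, (div_lt_one hu0).2 huw⟩
          have h2 : u ∈ Ioi (max 1 w) := max_lt hu huw
          rw [cesaroKernel, cesaroAdjointKernel, indicator_of_mem hu, indicator_of_mem h1,
            indicator_of_mem h2, abs_of_pos hu0, mul_one, ← Complex.ofReal_mul,
            Real.rpow_neg hu0.le, Real.rpow_two, sq, mul_inv]
        · have h1 : w / u ∉ Ioo (0 : ℝ) 1 := fun h => huw ((div_lt_one hu0).1 h.2)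
          have h2 : u ∉ Ioi (max 1 w) := fun h => huw ((le_max_right _ _).trans_lt h)
          rw [cesaroKernel, indicator_of_notMem h1, indicator_of_notMem h2]
          simp
      · have h2 : u ∉ Ioi (max 1 w) := fun h => hu (lt_of_le_of_lt (le_max_left 1 w) (mem_Ioi.1 h))
        rw [cesaroAdjointKernel, indicator_of_notMem hu, indicator_of_notMem h2]
        simp
    simp_rw [h]
    rw [integral_complex_ofReal, integral_indicator measurableSet_Ioi,
      integral_Ioi_rpow_of_lt (by norm_num) (lt_max_of_lt_left one_pos)]
    have e : ∀ x : ℝ, -x ^ (-2 + 1 : ℝ) / (-2 + 1) = x⁻¹ := by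
      intro x
      rw [show (-2 + 1 : ℝ) = -1 by norm_num, Real.rpow_neg_one]
      ring
    rw [e]
    rcases lt_or_gt_of_ne hw1 with h1 | h1
    · have h2 : w ∉ Ioi (1 : ℝ) := fun h => h1.not_gt h
      have h3 : w ∈ Ioo (0 : ℝ) 1 := ⟨hw, h1⟩
      rw [max_eq_left h1.le]
      simp [cesaroKernel, cesaroAdjointKernel, h2, h3]
    · have h2 : w ∈ Ioi (1 : ℝ) := h1
      have h3 : w ∉ Ioo (0 : ℝ) 1 := fun h => h.2.not_gt h1
      rw [max_eq_right h1.le]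
      simp [cesaroKernel, cesaroAdjointKernel, h2, h3]

/-- The inversion `u ↦ u⁻¹` carries `(1,∞)` onto `(0,1)`. Its Jacobian `u⁻²` is the product of the
kernel `u⁻¹` and the factor `u⁻¹` coming from `dilationPairing_conj`. -/
theorem star_cesaroOperator :
    star cesaroOperator = hausdorffOperator _ cesaroAdjointKernel_hausdorffKernel := by
  rw [ContinuousLinearMap.star_eq_adjoint]
  symm
  rw [ContinuousLinearMap.eq_adjoint_iff]
  intro f g
  have himg : (fun u : ℝ => u⁻¹) '' Ioi 1 = Ioo 0 1 := by
    ext u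
    constructor
    · rintro ⟨t, ht, rfl⟩
      exact ⟨inv_pos.2 (one_pos.trans ht), inv_lt_one_of_one_lt₀ ht⟩
    · rintro ⟨h0, h1⟩
      exact ⟨u⁻¹, (one_lt_inv₀ h0).2 h1, inv_inv u⟩
  have h1 : ∀ u, cesaroKernel u * dilationPairing f g u =
      (Ioo (0 : ℝ) 1).indicator (dilationPairing f g) u := by
    intro u
    by_cases hu : u ∈ Ioo (0 : ℝ) 1 <;> simp [cesaroKernel, hu]
  have h2 : ∀ u, (starRingEnd ℂ) (cesaroAdjointKernel u * dilationPairing g f u) =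
      (Ioi (1 : ℝ)).indicator (fun u => |-(u ^ 2)⁻¹| • dilationPairing f g u⁻¹) u := by
    intro u
    by_cases hu : u ∈ Ioi (1 : ℝ)
    · have hu0 : 0 < u := one_pos.trans hu
      have := dilationPairing_conj g f (inv_ne_zero hu0.ne')
      rw [inv_inv] at this
      rw [cesaroAdjointKernel, indicator_of_mem hu, indicator_of_mem hu, map_mul,
        Complex.conj_ofReal, this, ← mul_assoc, ← Complex.ofReal_mul, Complex.real_smul, abs_neg,
        abs_of_pos (inv_pos.2 hu0), abs_of_pos (by positivity), sq, mul_inv]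
    · simp [cesaroAdjointKernel, hu]
  rw [← inner_conj_symm, inner_hausdorffOperator, cesaroOperator, inner_hausdorffOperator,
    ← integral_conj]
  simp_rw [h1, h2]
  rw [integral_indicator measurableSet_Ioi, integral_indicator measurableSet_Ioo, ← himg,
    integral_image_eq_integral_abs_deriv_smul measurableSet_Ioi
      (fun u hu => (hasDerivAt_inv (one_pos.trans hu).ne').hasDerivWithinAt)
      inv_injective.injOn]

theorem cesaroOperator_mul_star :
    cesaroOperator * star cesaroOperator = cesaroOperator + star cesaroOperator := by
  rw [star_cesaroOperator, cesaroOperator, ← hausdorffOperator_add]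
  refine hausdorffOperator_comp measurable_cesaroKernel measurable_cesaroAdjointKernel _ _ _ ?_
  filter_upwards [Measure.ae_ne volume (1 : ℝ)] with w hw using cesaroKernel_conv_adjoint w hw

theorem star_mul_cesaroOperator :
    star cesaroOperator * cesaroOperator = cesaroOperator + star cesaroOperator := by
  rw [star_cesaroOperator, cesaroOperator, ← hausdorffOperator_add]
  refine hausdorffOperator_comp measurable_cesaroAdjointKernel measurable_cesaroKernel _ _ _ ?_
  filter_upwards [Measure.ae_ne volume (1 : ℝ)] with w hw using cesaroAdjointKernel_conv_cesaro w hw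

/-! ### Normality and location of the spectrum. -/

theorem isStarNormal_cesaroOperator : IsStarNormal cesaroOperator :=
  ⟨star_mul_cesaroOperator.trans cesaroOperator_mul_star.symm⟩

theorem one_sub_cesaroOperator_mem_unitary : 1 - cesaroOperator ∈ unitary (L2R →L[ℂ] L2R) := by
  rw [Unitary.mem_iff, star_sub, star_one]
  constructor
  · rw [sub_mul, mul_sub, mul_sub, star_mul_cesaroOperator]
    simp
  · rw [sub_mul, mul_sub, mul_sub, cesaroOperator_mul_star]
    simp

theorem norm_one_sub_of_mem_spectrum_cesaroOperator {z : ℂ} (hz : z ∈ spectrum ℂ cesaroOperator) :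
    ‖1 - z‖ = 1 := by
  have h : 1 - z ∈ spectrum ℂ (1 - cesaroOperator) := by
    have := spectrum.singleton_sub_eq (R := ℂ) cesaroOperator 1
    rw [map_one] at this
    rw [← this]
    exact Set.sub_mem_sub rfl hz
  simpa using spectrum.subset_circle_of_unitary one_sub_cesaroOperator_mem_unitary h

/-- Expanding `|1 - z|² = 1` gives `|z|² = 2 Re z`; divide by `|z|²`. Inversion thus sends the
nonzero spectrum into the line `Re s = 1/2`, where the Mellin integrals are controlled by the weight
`|u|^{-1/2}`. -/
theorem re_inv_of_mem_spectrum_cesaroOperator {z : ℂ} (hz : z ∈ spectrum ℂ cesaroOperator)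
    (h0 : z ≠ 0) : z⁻¹.re = 1 / 2 := by
  have h := congrArg (· ^ 2) (norm_one_sub_of_mem_spectrum_cesaroOperator hz)
  simp only [Complex.sq_norm, Complex.normSq_apply, Complex.sub_re, Complex.sub_im, Complex.one_re,
    Complex.one_im] at h
  have hn : Complex.normSq z ≠ 0 := by simpa using h0
  rw [Complex.inv_re, div_eq_iff hn, Complex.normSq_apply]
  linarith

theorem re_pos_of_mem_spectrum_cesaroOperator {z : ℂ} (hz : z ∈ spectrum ℂ cesaroOperator)
    (h0 : z ≠ 0) : 0 < z.re := by
  have h := re_inv_of_mem_spectrum_cesaroOperator hz h0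
  rw [Complex.inv_re, div_eq_iff (by simpa using h0)] at h
  have := Complex.normSq_pos.2 h0
  linarith

/-! ### The Laplace integral with complex parameter and the Mellin transform of the Hölder kernel.
-/

theorem norm_cpow_mul_exp_neg_mul {a r : ℂ} {t : ℝ} (ht : 0 < t) :
    ‖(t : ℂ) ^ a * Complex.exp (-(r * t))‖ = t ^ a.re * Real.exp (-(r.re * t)) := by
  rw [norm_mul, Complex.norm_cpow_eq_rpow_re_of_pos ht, Complex.norm_exp]
  simp

theorem integrableOn_rpow_mul_exp_neg_mul_Ioi {s b : ℝ} (hs : -1 < s) (hb : 0 < b) :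
    IntegrableOn (fun t : ℝ => t ^ s * Real.exp (-(b * t))) (Ioi 0) := by
  simpa using integrableOn_rpow_mul_exp_neg_mul_rpow (p := 1) hs one_pos hb

theorem integrableOn_cpow_mul_exp_neg_mul_Ioi {a r : ℂ} (ha : -1 < a.re) (hr : 0 < r.re) :
    IntegrableOn (fun t : ℝ => (t : ℂ) ^ a * Complex.exp (-(r * t))) (Ioi 0) := by
  refine Integrable.mono' (integrableOn_rpow_mul_exp_neg_mul_Ioi ha hr)
    (Measurable.aestronglyMeasurable (by fun_prop)) ?_
  filter_upwards [ae_restrict_mem measurableSet_Ioi] with t ht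
  exact (norm_cpow_mul_exp_neg_mul ht).le

theorem differentiableAt_integral_cpow_mul_exp {a r : ℂ} (ha : 0 < a.re) (hr : 0 < r.re) :
    DifferentiableAt ℂ (fun r : ℂ => ∫ t : ℝ in Ioi 0, (t : ℂ) ^ (a - 1) * Complex.exp (-(r * t)))
      r := by
  -- On the ball of radius `Re r / 2` about `r` the real part stays above `Re r / 2`, which gives a
  -- uniform exponential majorant for the derivative.
  have hb : 0 < r.re / 2 := by linarith
  refine (hasDerivAt_integral_of_dominated_loc_of_deriv_le
    (μ := volume.restrict (Ioi (0 : ℝ)))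
    (F := fun (r : ℂ) (t : ℝ) => (t : ℂ) ^ (a - 1) * Complex.exp (-(r * t)))
    (F' := fun (r : ℂ) (t : ℝ) => (t : ℂ) ^ (a - 1) * (Complex.exp (-(r * t)) * -(t : ℂ)))
    (bound := fun t : ℝ => t ^ a.re * Real.exp (-(r.re / 2 * t)))
    (Metric.ball_mem_nhds r hb) ?_ ?_ ?_ ?_ ?_ ?_).2.differentiableAt
  · exact Filter.Eventually.of_forall fun s => Measurable.aestronglyMeasurable (by fun_prop)
  · exact integrableOn_cpow_mul_exp_neg_mul_Ioi (by simpa using ha) hr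
  · exact Measurable.aestronglyMeasurable (by fun_prop)
  · filter_upwards [ae_restrict_mem measurableSet_Ioi] with t ht s hs
    have ht0 : (0 : ℝ) < t := ht
    have hre : r.re / 2 ≤ s.re := by
      have h1 := (Complex.abs_re_le_norm (s - r)).trans_lt (by simpa [dist_eq_norm] using hs)
      rw [Complex.sub_re] at h1
      linarith [(abs_lt.1 h1).1]
    rw [← mul_assoc, norm_mul, norm_cpow_mul_exp_neg_mul ht0, norm_neg, Complex.norm_real,
      Real.norm_of_nonneg ht0.le, mul_right_comm, ← Real.rpow_add_one ht0.ne']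
    simp only [Complex.sub_re, Complex.one_re, sub_add_cancel]
    gcongr
  · exact integrableOn_rpow_mul_exp_neg_mul_Ioi (by linarith) hb
  · refine Filter.Eventually.of_forall fun t s _ => ?_
    refine HasDerivAt.const_mul _ ?_
    have := ((hasDerivAt_id s).mul_const (t : ℂ)).neg.cexp
    simpa using this

/-- The Laplace transform of a power, for a complex parameter. -/
theorem integral_cpow_mul_exp_neg_mul_Ioi_of_re_pos {a r : ℂ} (ha : 0 < a.re) (hr : 0 < r.re) :
    ∫ t : ℝ in Ioi 0, (t : ℂ) ^ (a - 1) * Complex.exp (-(r * t)) =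
      (1 / r) ^ a * Complex.Gamma a := by
  have hopen : IsOpen {z : ℂ | 0 < z.re} := isOpen_lt continuous_const Complex.continuous_re
  have hF : AnalyticOnNhd ℂ
      (fun r : ℂ => ∫ t : ℝ in Ioi 0, (t : ℂ) ^ (a - 1) * Complex.exp (-(r * t)))
      {z : ℂ | 0 < z.re} :=
    DifferentiableOn.analyticOnNhd (fun z hz =>
      (differentiableAt_integral_cpow_mul_exp ha hz).differentiableWithinAt) hopen
  have hG : AnalyticOnNhd ℂ (fun r : ℂ => (1 / r) ^ a * Complex.Gamma a) {z : ℂ | 0 < z.re} := by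
    refine DifferentiableOn.analyticOnNhd (fun z hz => ?_) hopen
    have hz' : 0 < z.re := hz
    have h0 : z ≠ 0 := by rintro rfl; simp at hz'
    refine DifferentiableAt.differentiableWithinAt ?_
    refine (DifferentiableAt.cpow_const ?_ ?_).mul_const _
    · exact (differentiableAt_const _).div differentiableAt_id h0
    · left
      rw [one_div, Complex.inv_re]
      exact div_pos hz' (Complex.normSq_pos.2 h0)
  -- Identity theorem on the right half-plane: the two sides agree at positive real parameters,
  -- which accumulate at `1`.
  refine hF.eqOn_of_preconnected_of_frequently_eq hG
    (convex_halfSpace_re_gt 0).isPreconnected (z₀ := 1) (by simp) ?_ hr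
  have ht : Filter.Tendsto (fun x : ℝ => (x : ℂ)) (nhdsWithin 1 {1}ᶜ) (nhdsWithin 1 {1}ᶜ) := by
    refine tendsto_nhdsWithin_iff.2 ⟨?_, ?_⟩
    · have := (Complex.continuous_ofReal.tendsto 1).mono_left
        (nhdsWithin_le_nhds (s := ({1}ᶜ : Set ℝ)))
      simpa using this
    · filter_upwards [self_mem_nhdsWithin] with x hx
      simpa using hx
  refine ht.frequently (Filter.Eventually.frequently ?_)
  filter_upwards [nhdsWithin_le_nhds (lt_mem_nhds one_pos)] with x hx
  exact Complex.integral_cpow_mul_exp_neg_mul_Ioi ha hx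

/-- The substitution `u = e^{-t}` turns the integral into the Laplace transform of `t^{α-1}`, and
the Gamma factors cancel. In the form `(1 / s) ^ α`, setting `s = z⁻¹` yields `z ^ α` with no
question of branch. -/
theorem integral_holderKernel_mul_cpow {α s : ℂ} (hα : 0 < α.re) (hs : 0 < s.re) :
    ∫ u in Ioo (0 : ℝ) 1, holderKernel α u * (u : ℂ) ^ (s - 1) = (1 / s) ^ α := by
  have himg : (fun t : ℝ => Real.exp (-t)) '' Ioi 0 = Ioo 0 1 := by
    ext u
    constructor
    · rintro ⟨t, ht, rfl⟩
      exact ⟨Real.exp_pos _, by simpa using ht⟩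
    · rintro ⟨h0, h1⟩
      exact ⟨-Real.log u, by simpa using Real.log_neg h0 h1, by simp [Real.exp_log h0]⟩
  rw [setIntegral_congr_fun (g := fun u : ℝ => (Complex.Gamma α)⁻¹ *
      (Real.log (1 / u) : ℂ) ^ (α - 1) * (u : ℂ) ^ (s - 1)) measurableSet_Ioo
      (fun u hu => by simp only [holderKernel, indicator_of_mem hu]),
    ← himg, integral_image_eq_integral_abs_deriv_smul measurableSet_Ioi
      (f' := fun t => -Real.exp (-t))
      (fun t _ => by simpa using ((hasDerivAt_neg t).exp).hasDerivWithinAt)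
      (fun a _ b _ h => by simpa using h)]
  have hG : Complex.Gamma α ≠ 0 := Complex.Gamma_ne_zero_of_re_pos hα
  rw [← mul_right_inj' hG, mul_comm _ ((1 / s) ^ α),
    ← integral_cpow_mul_exp_neg_mul_Ioi_of_re_pos hα hs, ← integral_const_mul]
  refine setIntegral_congr_fun measurableSet_Ioi fun t _ => ?_
  have he : ((Real.exp (-t) : ℝ) : ℂ) ^ (s - 1) = Complex.exp (-(s * t)) * Complex.exp t := by
    rw [Complex.cpow_def_of_ne_zero (by exact_mod_cast (Real.exp_pos _).ne'),
      ← Complex.ofReal_log (Real.exp_pos _).le, Real.log_exp, ← Complex.exp_add]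
    congr 1
    push_cast
    ring
  have he' : ((Real.exp (-t) : ℝ) : ℂ) * Complex.exp t = 1 := by
    rw [Complex.ofReal_exp, ← Complex.exp_add]
    simp
  simp only [abs_neg, Real.abs_exp, one_div, Real.log_inv, Real.log_exp, neg_neg,
    Complex.real_smul]
  rw [he]
  linear_combination (Complex.Gamma α * (Complex.Gamma α)⁻¹ * (t : ℂ) ^ (α - 1) *
    Complex.exp (-(s * t))) * he' + ((t : ℂ) ^ (α - 1) * Complex.exp (-(s * t))) *
    mul_inv_cancel₀ hG

/-! ### The Mellin transform on the line `Re s = 1/2`. -/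

/-- The Mellin transform of a kernel on `(0,1)`. -/
noncomputable def unitMellin (K : ℝ → ℂ) (s : ℂ) : ℂ :=
  ∫ u in Ioo (0 : ℝ) 1, K u * (u : ℂ) ^ (s - 1)

theorem norm_mul_cpow_of_re_eq_half (z : ℂ) {s : ℂ} (hs : s.re = 1 / 2) {u : ℝ} (hu : 0 < u) :
    ‖z * (u : ℂ) ^ (s - 1)‖ = ‖z * ((|u| ^ (-(1 / 2) : ℝ) : ℝ) : ℂ)‖ := by
  rw [norm_mul, norm_mul, Complex.norm_cpow_eq_rpow_re_of_pos hu, Complex.norm_real,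
    Real.norm_of_nonneg (by positivity), abs_of_pos hu, Complex.sub_re, hs, Complex.one_re]
  norm_num

theorem HausdorffKernel.integrableOn_mul_cpow {K : ℝ → ℂ} (hK : HausdorffKernel K) {s : ℂ}
    (hs : s.re = 1 / 2) :
    IntegrableOn (fun u : ℝ => K u * (u : ℂ) ^ (s - 1)) (Ioo 0 1) := by
  refine Integrable.mono (Integrable.integrableOn hK) ?_ ?_
  · exact hK.aestronglyMeasurable.restrict.mul (Measurable.aestronglyMeasurable (by fun_prop))
  · filter_upwards [ae_restrict_mem measurableSet_Ioo] with u hu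
    exact (norm_mul_cpow_of_re_eq_half _ hs hu.1).le

/-- On this line `|u^{s-1}|` is exactly the weight `u^{-1/2}`. The bound is the same constant that
bounds the operator norm in `norm_hausdorffOperator_le`. -/
theorem norm_unitMellin_le {K : ℝ → ℂ} (hK : HausdorffKernel K) {s : ℂ} (hs : s.re = 1 / 2) :
    ‖unitMellin K s‖ ≤ hausdorffBound K := by
  refine (norm_integral_le_integral_norm _).trans ?_
  rw [setIntegral_congr_fun measurableSet_Ioo
    (fun u hu => norm_mul_cpow_of_re_eq_half (K u) hs hu.1)]
  exact setIntegral_le_integral (Integrable.norm hK)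
    (Filter.Eventually.of_forall fun _ => norm_nonneg _)

theorem unitMellin_add {K L : ℝ → ℂ} (hK : HausdorffKernel K) (hL : HausdorffKernel L) {s : ℂ}
    (hs : s.re = 1 / 2) : unitMellin (K + L) s = unitMellin K s + unitMellin L s := by
  simp only [unitMellin, Pi.add_apply, add_mul]
  exact integral_add (hK.integrableOn_mul_cpow hs) (hL.integrableOn_mul_cpow hs)

theorem unitMellin_smul (K : ℝ → ℂ) (c s : ℂ) : unitMellin (c • K) s = c * unitMellin K s := by
  simp only [unitMellin, Pi.smul_apply, smul_eq_mul, mul_assoc]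
  exact integral_const_mul _ _

/-! ### Polynomial kernels and the functional calculus. -/

open Polynomial in
/-- The restriction of a polynomial to `(0,1)`, as a kernel on `ℝ`. -/
noncomputable def polynomialKernel (p : ℂ[X]) : ℝ → ℂ :=
  (Ioo (0 : ℝ) 1).indicator fun u => p.eval (u : ℂ)

section

open Polynomial

theorem polynomialKernel_add (p q : ℂ[X]) :
    polynomialKernel (p + q) = polynomialKernel p + polynomialKernel q := by
  ext u
  by_cases hu : u ∈ Ioo (0 : ℝ) 1 <;> simp [polynomialKernel, hu]

theorem polynomialKernel_smul (c : ℂ) (p : ℂ[X]) :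
    polynomialKernel (c • p) = c • polynomialKernel p := by
  ext u
  by_cases hu : u ∈ Ioo (0 : ℝ) 1 <;> simp [polynomialKernel, hu]

theorem measurable_polynomialKernel (p : ℂ[X]) : Measurable (polynomialKernel p) :=
  (p.continuous.comp Complex.continuous_ofReal).measurable.indicator measurableSet_Ioo

theorem polynomialKernel_hausdorffKernel (p : ℂ[X]) : HausdorffKernel (polynomialKernel p) := by
  have hc : Continuous fun u : ℝ => p.eval (u : ℂ) := p.continuous.comp Complex.continuous_ofReal
  obtain ⟨c, hc⟩ := (isCompact_Icc (a := (0 : ℝ)) (b := 1)).exists_bound_of_continuousOn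
    hc.continuousOn
  refine (Integrable.bdd_mul (c := |c|) cesaroKernel_hausdorffKernel
    (measurable_polynomialKernel p).aestronglyMeasurable (Filter.Eventually.of_forall fun u => ?_)).congr
    (Filter.Eventually.of_forall fun u => ?_)
  · by_cases hu : u ∈ Ioo (0 : ℝ) 1
    · simpa [polynomialKernel, hu] using (hc u (Ioo_subset_Icc_self hu)).trans (le_abs_self c)
    · simp [polynomialKernel, hu]
  · by_cases hu : u ∈ Ioo (0 : ℝ) 1 <;> simp [polynomialKernel, cesaroKernel, hu]

/-- The Hausdorff operator whose kernel is a polynomial on `(0,1)`. -/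
noncomputable def polynomialOperator (p : ℂ[X]) : L2R →L[ℂ] L2R :=
  hausdorffOperator _ (polynomialKernel_hausdorffKernel p)

theorem polynomialOperator_add (p q : ℂ[X]) :
    polynomialOperator (p + q) = polynomialOperator p + polynomialOperator q := by
  rw [polynomialOperator, polynomialOperator, polynomialOperator, ← hausdorffOperator_add]
  exact hausdorffOperator_congr _ _ (by rw [polynomialKernel_add])

theorem polynomialOperator_smul (c : ℂ) (p : ℂ[X]) :
    polynomialOperator (c • p) = c • polynomialOperator p := by
  rw [polynomialOperator, polynomialOperator, ← hausdorffOperator_smul]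
  exact hausdorffOperator_congr _ _ (by rw [polynomialKernel_smul])

theorem polynomialOperator_one : polynomialOperator 1 = cesaroOperator :=
  hausdorffOperator_congr _ _ (by simp [polynomialKernel, cesaroKernel])

/-- For `0 < w < 1` the integral is `∫_w^1 u^m du`, the factor `|u|⁻¹` having lowered the exponent
by one. Starting at exponent `m + 1` avoids `∫ u⁻¹ du`, a logarithm. -/
theorem polynomialKernel_conv_cesaro (m : ℕ) (w : ℝ) :
    ∫ u : ℝ, polynomialKernel (X ^ (m + 1)) u * ((|u|⁻¹ : ℝ) : ℂ) * cesaroKernel (w / u) =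
      polynomialKernel (((m : ℂ) + 1)⁻¹ • (1 - X ^ (m + 1))) w := by
  by_cases hw : w ∈ Ioo (0 : ℝ) 1
  · have h : ∀ u, polynomialKernel (X ^ (m + 1)) u * ((|u|⁻¹ : ℝ) : ℂ) * cesaroKernel (w / u) =
        (Ioo w 1).indicator (fun u => ((u ^ m : ℝ) : ℂ)) u := by
      intro u
      by_cases hu : u ∈ Ioo (0 : ℝ) 1
      · by_cases huw : w < u
        · have h1 : w / u ∈ Ioo (0 : ℝ) 1 := ⟨div_pos hw.1 hu.1, (div_lt_one hu.1).2 huw⟩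
          have h2 : u ∈ Ioo w 1 := ⟨huw, hu.2⟩
          have h3 : (u : ℂ) ≠ 0 := by exact_mod_cast hu.1.ne'
          simp [polynomialKernel, cesaroKernel, hu, h1, h2, abs_of_pos hu.1, pow_succ, h3]
        · have h1 : w / u ∉ Ioo (0 : ℝ) 1 := fun h => huw ((div_lt_one hu.1).1 h.2)
          have h2 : u ∉ Ioo w 1 := fun h => huw h.1
          rw [cesaroKernel, indicator_of_notMem h1, indicator_of_notMem h2, mul_zero]
      · have h2 : u ∉ Ioo w 1 := fun h => hu ⟨hw.1.trans h.1, h.2⟩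
        rw [polynomialKernel, indicator_of_notMem hu, indicator_of_notMem h2, zero_mul, zero_mul]
    simp_rw [h]
    rw [integral_indicator measurableSet_Ioo, integral_complex_ofReal, ← integral_Ioc_eq_integral_Ioo,
      ← intervalIntegral.integral_of_le hw.2.le, integral_pow, polynomialKernel,
      indicator_of_mem hw]
    simp [div_eq_inv_mul]
  · have h : ∀ u, polynomialKernel (X ^ (m + 1)) u * ((|u|⁻¹ : ℝ) : ℂ) * cesaroKernel (w / u) =
        0 := by
      intro u
      by_cases hu : u ∈ Ioo (0 : ℝ) 1
      · have h1 : w / u ∉ Ioo (0 : ℝ) 1 := by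
          intro h
          have h2 : 0 < w := by simpa [div_mul_cancel₀ w hu.1.ne'] using mul_pos h.1 hu.1
          exact hw ⟨h2, ((div_lt_one hu.1).1 h.2).trans hu.2⟩
        rw [cesaroKernel, indicator_of_notMem h1, mul_zero]
      · rw [polynomialKernel, indicator_of_notMem hu, zero_mul, zero_mul]
    simp_rw [h]
    simp [polynomialKernel, hw]

/-- For positive exponent `n` the convolution formula reads `n P 𝓒 = 𝓒 - P`, where `P` is the
operator of `u^n`; for exponent `0`, `P` is already `𝓒`. -/
theorem polynomialOperator_X_pow_mul (m : ℕ) :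
    polynomialOperator (X ^ m) * (1 + (m : ℂ) • cesaroOperator) = cesaroOperator := by
  rcases m with _ | m
  · simp [polynomialOperator_one]
  · have hm : (m : ℂ) + 1 ≠ 0 := by exact_mod_cast m.succ_ne_zero
    have h : polynomialOperator (X ^ (m + 1)) * cesaroOperator =
        polynomialOperator (((m : ℂ) + 1)⁻¹ • (1 - X ^ (m + 1))) :=
      hausdorffOperator_comp (measurable_polynomialKernel _) measurable_cesaroKernel _ _ _
        (Filter.Eventually.of_forall (polynomialKernel_conv_cesaro m))
    have h' : (1 : ℂ[X]) - X ^ (m + 1) = 1 + (-1 : ℂ) • X ^ (m + 1) := by simp [sub_eq_add_neg]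
    rw [mul_add, mul_one, mul_smul_comm, h, polynomialOperator_smul, Nat.cast_succ,
      smul_inv_smul₀ hm, h', polynomialOperator_add, polynomialOperator_smul,
      polynomialOperator_one]
    simp

theorem one_add_nat_mul_ne_zero {z : ℂ} (hz : z ∈ spectrum ℂ cesaroOperator) (m : ℕ) :
    1 + m * z ≠ 0 := by
  by_cases h0 : z = 0
  · simp [h0]
  · intro h
    have h1 := re_pos_of_mem_spectrum_cesaroOperator hz h0
    have h2 := congrArg Complex.re h
    simp at h2
    nlinarith [mul_nonneg (Nat.cast_nonneg (α := ℝ) m) h1.le]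

theorem continuousOn_div_one_add_nat_mul (m : ℕ) :
    ContinuousOn (fun z : ℂ => z * (1 + m * z)⁻¹) (spectrum ℂ cesaroOperator) :=
  continuousOn_id.mul (ContinuousOn.inv₀ (by fun_prop) fun _ hz => one_add_nat_mul_ne_zero hz m)

/-- Since `1 + mz` has no zero on the spectrum, the calculus provides an inverse of `1 + m𝓒`;
multiplying `P (1 + m𝓒) = 𝓒` by it identifies `P`. -/
theorem cfc_div_one_add_nat_mul (m : ℕ) :
    cfc (fun z : ℂ => z * (1 + m * z)⁻¹) cesaroOperator = polynomialOperator (X ^ m) := by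
  have hN := isStarNormal_cesaroOperator
  have hi : ContinuousOn (fun z : ℂ => (1 + m * z)⁻¹) (spectrum ℂ cesaroOperator) :=
    ContinuousOn.inv₀ (by fun_prop) fun _ hz => one_add_nat_mul_ne_zero hz m
  have h1 : cfc (fun z : ℂ => 1 + m * z) cesaroOperator = 1 + (m : ℂ) • cesaroOperator := by
    rw [cfc_add cesaroOperator (fun _ => 1) (fun z : ℂ => m * z), cfc_const_one ℂ cesaroOperator,
      cfc_const_mul_id (m : ℂ) cesaroOperator]
  have h2 : (1 + (m : ℂ) • cesaroOperator) * cfc (fun z : ℂ => (1 + m * z)⁻¹) cesaroOperator =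
      1 := by
    rw [← h1, ← cfc_mul (fun z : ℂ => 1 + m * z) (fun z : ℂ => (1 + m * z)⁻¹) cesaroOperator
      (by fun_prop) hi, ← cfc_const_one ℂ cesaroOperator]
    exact cfc_congr fun z hz => mul_inv_cancel₀ (one_add_nat_mul_ne_zero hz m)
  rw [cfc_mul (fun z : ℂ => z) (fun z : ℂ => (1 + m * z)⁻¹) cesaroOperator (by fun_prop) hi,
    cfc_id' ℂ cesaroOperator]
  calc _ = polynomialOperator (X ^ m) * (1 + (m : ℂ) • cesaroOperator) *
        cfc (fun z : ℂ => (1 + m * z)⁻¹) cesaroOperator := by rw [polynomialOperator_X_pow_mul]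
    _ = _ := by rw [mul_assoc, h2, mul_one]

theorem unitMellin_X_pow (m : ℕ) {z : ℂ} (hz : z⁻¹.re = 1 / 2) :
    unitMellin (polynomialKernel (X ^ m)) z⁻¹ = z * (1 + m * z)⁻¹ := by
  have h0 : z ≠ 0 := by rintro rfl; norm_num at hz
  have hre : (m + z⁻¹ : ℂ).re = m + 1 / 2 := by simp [hz]
  have hne : (m + z⁻¹ : ℂ) ≠ 0 := by
    intro h
    rw [h, Complex.zero_re] at hre
    linarith [Nat.cast_nonneg (α := ℝ) m]
  rw [unitMellin, setIntegral_congr_fun (g := fun u : ℝ => (u : ℂ) ^ (m + z⁻¹ - 1 : ℂ))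
    measurableSet_Ioo, ← integral_Ioc_eq_integral_Ioo,
    ← intervalIntegral.integral_of_le zero_le_one, integral_cpow]
  · have e : z * (m + z⁻¹) = 1 + m * z := by
      rw [mul_add, mul_inv_cancel₀ h0]
      ring
    simp only [sub_add_cancel, Complex.ofReal_one, Complex.one_cpow, Complex.ofReal_zero]
    rw [Complex.zero_cpow hne, ← e, mul_inv, mul_inv_cancel_left₀ h0, sub_zero, one_div]
  · left
    rw [Complex.sub_re, hre, Complex.one_re]
    linarith [Nat.cast_nonneg (α := ℝ) m]
  · intro u hu
    have hu0 : (u : ℂ) ≠ 0 := by exact_mod_cast hu.1.ne'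
    simp only [polynomialKernel, indicator_of_mem hu, eval_pow, eval_X]
    rw [← Complex.cpow_natCast, ← Complex.cpow_add _ _ hu0, add_sub_assoc]

/-- Linear extension from monomials. The value at `0` is a separate clause: `0⁻¹ = 0` is off the
line `Re s = 1/2`, so the Mellin formula says nothing there, while `0` is not excluded from the
spectrum. -/
theorem exists_cfc_eq_polynomialOperator (p : ℂ[X]) :
    ∃ g : ℂ → ℂ, ContinuousOn g (spectrum ℂ cesaroOperator) ∧ g 0 = 0 ∧
      (∀ z : ℂ, z⁻¹.re = 1 / 2 → g z = unitMellin (polynomialKernel p) z⁻¹) ∧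
      cfc g cesaroOperator = polynomialOperator p := by
  induction p using Polynomial.induction_on' with
  | add p q hp hq =>
    obtain ⟨f, f1, f2, f3, f4⟩ := hp
    obtain ⟨g, g1, g2, g3, g4⟩ := hq
    refine ⟨fun z => f z + g z, f1.add g1, by simp [f2, g2], fun z hz => ?_, ?_⟩
    · simp only [f3 z hz, g3 z hz]
      rw [polynomialKernel_add, unitMellin_add (polynomialKernel_hausdorffKernel p)
        (polynomialKernel_hausdorffKernel q) hz]
    · rw [cfc_add cesaroOperator f g f1 g1, f4, g4, polynomialOperator_add]
  | monomial m c =>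
    rw [← C_mul_X_pow_eq_monomial, ← smul_eq_C_mul]
    refine ⟨fun z => c * (z * (1 + m * z)⁻¹),
      continuousOn_const.mul (continuousOn_div_one_add_nat_mul m), by simp, fun z hz => ?_, ?_⟩
    · rw [polynomialKernel_smul, unitMellin_smul, unitMellin_X_pow m hz]
    · rw [cfc_const_mul c _ cesaroOperator (continuousOn_div_one_add_nat_mul m),
        cfc_div_one_add_nat_mul, polynomialOperator_smul]

end

/-! ### Density of polynomial kernels in the weighted `L¹` norm. -/

theorem exists_complex_polynomial_near {g : ℝ → ℂ} (hg : Continuous g) {ε : ℝ} (hε : 0 < ε) :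
    ∃ p : Polynomial ℂ, ∀ u ∈ Icc (0 : ℝ) 1, ‖g u - p.eval (u : ℂ)‖ ≤ ε := by
  obtain ⟨p, hp⟩ := exists_polynomial_near_of_continuousOn 0 1 (fun u => (g u).re)
    (Complex.continuous_re.comp hg).continuousOn (ε / 2) (half_pos hε)
  obtain ⟨q, hq⟩ := exists_polynomial_near_of_continuousOn 0 1 (fun u => (g u).im)
    (Complex.continuous_im.comp hg).continuousOn (ε / 2) (half_pos hε)
  refine ⟨p.map Complex.ofRealHom + Polynomial.C Complex.I * q.map Complex.ofRealHom,
    fun u hu => ?_⟩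
  have e : ∀ r : Polynomial ℝ, (r.map Complex.ofRealHom).eval (u : ℂ) = ((r.eval u : ℝ) : ℂ) := by
    intro r
    exact Polynomial.eval_map_apply Complex.ofRealHom u
  refine (Complex.norm_le_abs_re_add_abs_im _).trans ?_
  simp only [Polynomial.eval_add, Polynomial.eval_mul, Polynomial.eval_C, e, Complex.sub_re,
    Complex.sub_im, Complex.add_re, Complex.add_im, Complex.mul_re, Complex.mul_im, Complex.I_re,
    Complex.I_im, Complex.ofReal_re, Complex.ofReal_im]
  have h1 := hp u hu
  have h2 := hq u hu
  rw [abs_sub_comm] at h1 h2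
  ring_nf at h1 h2 ⊢
  linarith

/-- The measure `|u|^{-1/2} du` on `(0,1)`. -/
noncomputable def unitWeight : Measure ℝ :=
  (volume.restrict (Ioo 0 1)).withDensity fun u => ENNReal.ofReal (|u| ^ (-(1 / 2) : ℝ))

theorem measurable_unitWeight_density :
    Measurable fun u : ℝ => ENNReal.ofReal (|u| ^ (-(1 / 2) : ℝ)) := by fun_prop

/-- The weight `u^{-1/2}` is integrable at `0`. Finiteness lets uniform approximation on `[0,1]`
imply approximation in `L¹(unitWeight)`. -/
instance : IsFiniteMeasure unitWeight := by
  refine isFiniteMeasure_withDensity_ofReal (Integrable.hasFiniteIntegral ?_)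
  have h := (Integrable.integrableOn (s := Ioo 0 1) cesaroKernel_hausdorffKernel).norm
  refine h.congr ?_
  filter_upwards [ae_restrict_mem measurableSet_Ioo] with u hu
  simp only [cesaroKernel, indicator_of_mem hu, one_mul, Complex.norm_real]
  exact Real.norm_of_nonneg (by positivity)

theorem HausdorffKernel.integrable_unitWeight {K : ℝ → ℂ} (hK : HausdorffKernel K) :
    Integrable K unitWeight := by
  rw [unitWeight, integrable_withDensity_iff_integrable_smul' measurable_unitWeight_density
    (Filter.Eventually.of_forall fun _ => ENNReal.ofReal_lt_top)]
  refine (Integrable.integrableOn hK).congr (Filter.Eventually.of_forall fun u => ?_)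
  simp only [ENNReal.toReal_ofReal (Real.rpow_nonneg (abs_nonneg u) _), Complex.real_smul]
  exact mul_comm _ _

theorem hausdorffBound_eq_integral_unitWeight {K : ℝ → ℂ} (h : ∀ u ∉ Ioo (0 : ℝ) 1, K u = 0) :
    hausdorffBound K = ∫ u, ‖K u‖ ∂unitWeight := by
  rw [unitWeight, integral_withDensity_eq_integral_toReal_smul measurable_unitWeight_density
    (Filter.Eventually.of_forall fun _ => ENNReal.ofReal_lt_top), hausdorffBound,
    ← setIntegral_eq_integral_of_forall_compl_eq_zero (s := Ioo 0 1)
      (fun u hu => by rw [h u hu]; simp)]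
  refine setIntegral_congr_fun measurableSet_Ioo fun u _ => ?_
  simp only [norm_mul, Complex.norm_real, smul_eq_mul,
    Real.norm_of_nonneg (Real.rpow_nonneg (abs_nonneg u) _),
    ENNReal.toReal_ofReal (Real.rpow_nonneg (abs_nonneg u) _)]
  exact mul_comm _ _

theorem ae_unitWeight_mem : ∀ᵐ u ∂unitWeight, u ∈ Ioo (0 : ℝ) 1 :=
  (withDensity_absolutelyContinuous _ _).ae_le (ae_restrict_mem measurableSet_Ioo)

/-- Polynomial kernels are dense among the Hausdorff kernels supported on `(0,1)`. -/
theorem exists_hausdorffBound_sub_polynomialKernel_le {K : ℝ → ℂ} (hK : HausdorffKernel K)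
    (h : ∀ u ∉ Ioo (0 : ℝ) 1, K u = 0) {ε : ℝ} (hε : 0 < ε) :
    ∃ p, hausdorffBound (K + (-1 : ℂ) • polynomialKernel p) ≤ ε := by
  -- Half of `ε` is spent on a continuous approximation in `L¹`, the other half on Weierstrass
  -- approximation of that function.
  obtain ⟨g, hg, hgi⟩ := hK.integrable_unitWeight.exists_boundedContinuous_integral_sub_le
    (half_pos hε)
  have hW : 0 ≤ unitWeight.real univ := measureReal_nonneg
  -- The tolerance is `ε/2` divided by the total mass plus one; the added one makes the denominator
  -- positive without a lower bound on the mass.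
  obtain ⟨p, hp⟩ := exists_complex_polynomial_near g.continuous
    (div_pos (half_pos hε) (add_pos_of_nonneg_of_pos hW one_pos))
  refine ⟨p, ?_⟩
  have hd := hK.add ((polynomialKernel_hausdorffKernel p).smul (-1))
  rw [hausdorffBound_eq_integral_unitWeight
    (fun u hu => by simp [h u hu, polynomialKernel, hu])]
  have hi : Integrable (fun u => ‖K u - g u‖) unitWeight :=
    (hK.integrable_unitWeight.sub hgi).norm
  calc ∫ u, ‖(K + (-1 : ℂ) • polynomialKernel p) u‖ ∂unitWeight
      ≤ ∫ u, (‖K u - g u‖ + ε / 2 / (unitWeight.real univ + 1)) ∂unitWeight := by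
        refine integral_mono_ae hd.integrable_unitWeight.norm
          (hi.add (integrable_const _)) ?_
        filter_upwards [ae_unitWeight_mem] with u hu
        have e : (K + (-1 : ℂ) • polynomialKernel p) u =
            (K u - g u) + (g u - p.eval (u : ℂ)) := by
          simp [polynomialKernel, hu, sub_eq_add_neg]
        rw [e]
        exact (norm_add_le _ _).trans (add_le_add_right (hp u (Ioo_subset_Icc_self hu)) _)
    _ = ∫ u, ‖K u - g u‖ ∂unitWeight +
          unitWeight.real univ * (ε / 2 / (unitWeight.real univ + 1)) := by
        rw [integral_add hi (integrable_const _), integral_const, smul_eq_mul]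
    _ ≤ ε / 2 + ε / 2 := by
        refine add_le_add hg ?_
        rw [mul_div_assoc', div_le_iff₀ (by linarith)]
        nlinarith
    _ = ε := add_halves ε

/-! ### Passage to the Hölder kernel. -/

theorem continuousOn_cpow_spectrum_cesaroOperator {α : ℂ} (hα : 0 < α.re) :
    ContinuousOn (fun z : ℂ => z ^ α) (spectrum ℂ cesaroOperator) := by
  intro z hz
  refine ContinuousAt.continuousWithinAt ?_
  by_cases h0 : z = 0
  · subst h0
    exact ContinuousAt.comp (f := fun z : ℂ => (z, α)) (g := fun x : ℂ × ℂ => x.1 ^ x.2)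
      (Complex.continuousAt_cpow_zero_of_re_pos hα)
      (continuousAt_id.prodMk continuousAt_const)
  · exact continuousAt_id.cpow continuousAt_const
      (Or.inl (re_pos_of_mem_spectrum_cesaroOperator hz h0))

/-- Both operators are compared with one polynomial operator. The same difference kernel controls
both errors: through its Mellin transform on the spectrum for `𝓒^α`, and through the operator norm
bound for the Hölder mean. -/
theorem norm_cfc_cpow_sub_holderOperator_le {α : ℂ} (hα : 0 < α.re) {ε : ℝ} (hε : 0 < ε) :
    ‖cfc (fun z : ℂ => z ^ α) cesaroOperator - holderOperator α hα‖ ≤ ε + ε := by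
  have hK := holderKernel_hausdorffKernel hα
  obtain ⟨p, hp⟩ := exists_hausdorffBound_sub_polynomialKernel_le hK
    (fun u hu => indicator_of_notMem hu _) hε
  obtain ⟨g, hg, hg0, hgm, hgc⟩ := exists_cfc_eq_polynomialOperator p
  have hP := polynomialKernel_hausdorffKernel p
  have hd := hK.add (hP.smul (-1))
  have h1 : ‖cfc (fun z : ℂ => z ^ α) cesaroOperator - polynomialOperator p‖ ≤ ε := by
    rw [← hgc, ← cfc_sub (fun z : ℂ => z ^ α) g cesaroOperator
      (continuousOn_cpow_spectrum_cesaroOperator hα) hg]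
    refine norm_cfc_le hε.le fun z hz => ?_
    -- At `0` both functions vanish; elsewhere their difference is a Mellin transform at `z⁻¹`.
    by_cases h0 : z = 0
    · have hα0 : α ≠ 0 := by rintro rfl; simp at hα
      rw [h0, hg0, Complex.zero_cpow hα0, sub_zero, norm_zero]
      exact hε.le
    · have hs := re_inv_of_mem_spectrum_cesaroOperator hz h0
      have e : z ^ α - g z = unitMellin (holderKernel α + (-1 : ℂ) • polynomialKernel p) z⁻¹ := by
        rw [unitMellin_add hK (hP.smul (-1)) hs, unitMellin_smul, ← hgm z hs, unitMellin,
          integral_holderKernel_mul_cpow hα (by rw [hs]; norm_num), one_div, inv_inv]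
        ring
      rw [e]
      exact (norm_unitMellin_le hd hs).trans hp
  have h2 : ‖polynomialOperator p - holderOperator α hα‖ ≤ ε := by
    rw [norm_sub_rev]
    have e : holderOperator α hα - polynomialOperator p = hausdorffOperator _ hd := by
      rw [hausdorffOperator_add hK (hP.smul (-1)), hausdorffOperator_smul, neg_one_smul,
        ← sub_eq_add_neg]
      rfl
    rw [e]
    exact (norm_hausdorffOperator_le hd).trans hp
  exact (norm_sub_le_norm_sub_add_norm_sub _ _ _).trans (add_le_add h1 h2)

theorem mainTheorem2 (α : ℂ) (hα : 0 < α.re) :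
    IsStarNormal cesaroOperator ∧
    spectrum ℂ cesaroOperator ⊆ {z : ℂ | 0 < z.re} ∪ {0} ∧
    ContinuousOn (fun z : ℂ => z ^ α) (spectrum ℂ cesaroOperator) ∧
    cfc (fun z : ℂ => z ^ α) cesaroOperator = holderOperator α hα := by
  refine ⟨isStarNormal_cesaroOperator, fun z hz => ?_,
    continuousOn_cpow_spectrum_cesaroOperator hα, ?_⟩
  · by_cases h0 : z = 0
    · exact Or.inr h0
    · exact Or.inl (re_pos_of_mem_spectrum_cesaroOperator hz h0)
  · rw [← sub_eq_zero, ← norm_le_zero_iff]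
    refine le_of_forall_pos_le_add fun ε hε => ?_
    have := norm_cfc_cpow_sub_holderOperator_le hα (half_pos hε)
    linarith
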